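/- Let $V$ be a rational vector space with a symmetric bilinear form $u\cdot v$ (not assumed positive definite), and let $\Lambda\subset V$ be a lattice, i.e. a finitely generated subgroup spanning $V$ over $\mathbb Q$, so that $V=\Lambda\otimes\mathbb Q$. Let $\Lambda^*=\{v\in V: v\cdot\Lambda\subseteq\mathbb Z\}$, and for a set $\Pi$ of rational primes let the $\Pi$-dual $\Lambda^{*_\Pi}$ be the set of $v\in V$ with $v\cdot\Lambda\subseteq\mathbb Z_p$ for all $p\in\Pi$ and $v\cdot\Lambda^*\subseteq\mathbb Z_p$ for all primes $p\notin\Pi$; write $\overline\Pi$ for the set of primes not in $\Pi$. For a 2-integral lattice $M$ (i.e. $u\cdot v\in\mathbb Z_2$ for all $u,v\in M$) put $M_0=\{u\in M: u\cdot u\in 2\mathbb Z_2\}$; the shadow $S(M)$ is $M^*$ if $M=M_0$, and $(M_0)^*\setminus M^*$ otherwise. The $\Pi$-shadow of $\Lambda$ is $$S_\Pi(\Lambda)=S(\Lambda^{*_{\overline\Pi}})\ \text{ if } 2\in\Pi,\qquad S_\Pi(\Lambda)=\sqrt{l}\,S\bigl(\sqrt{l}\,\Lambda^{*_{\overline\Pi}}\bigr)\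 \text{ if } 2\notin\Pi,$$ where $l$ is the 2-level of $\Lambda$, the smallest positive integer such that $\sqrt l\,\Lambda^{*_{\{2\}}}$ is integral. The oddity of $\Lambda$ is the integer modulo $8$ obtained by diagonalizing the form over $\mathbb Q$ as $\operatorname{diag}(2^{k_1}u_1,\dots,2^{k_n}u_n)$ with 2-adic units $u_i$ and taking $u_1+\dots+u_n+4m \bmod 8$, where $m$ is the number of $i$ with $k_i$ odd and $u_i\equiv\pm3\pmod 8$. Theorem. Let $\Lambda$ be a 2-integral lattice of odd determinant (the Gram determinant of a $\mathbb Z$-basis is a rational number with odd numerator and odd denominator), and let $\Pi$ be any set of rational primes. Then every vector $v\in S_\Pi(\Lambda)$ satisfies $$v\cdot v\equiv \frac{\operatorname{oddity}(\Lambda)}{4}\pmod{2\mathbb Z_2}.$$ -/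

import Mathlib

/-! Throughout, `V` is a rational vector space with a bilinear form `B` (written `u · v` in
comments), and a lattice is a finitely generated subgroup `L` of `V` spanning `V` over `ℚ`, so that
`V = L ⊗ ℚ`. The rescaled lattice `√l L` is modelled by the lattice `L` with the form `l B`. -/

namespace Shadow

/-- The rational number `q` lies in `ℤ_p`. -/
def InZp (p : ℕ) [Fact p.Prime] (q : ℚ) : Prop :=
  (q : ℚ_[p]) ∈ PadicInt.subring p

/-- The rational number `q` lies in `2 ℤ_2`. -/
def InTwoZ2 (q : ℚ) : Prop :=
  ∃ z : ℤ_[2], (q : ℚ_[2]) = 2 * (z : ℚ_[2])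

section

variable {V : Type*} [AddCommGroup V] [Module ℚ V]

/-- `u · v ∈ ℤ_2` for all `u, v ∈ L`. -/
def IsTwoIntegral (B : LinearMap.BilinForm ℚ V) (L : Submodule ℤ V) : Prop :=
  ∀ u ∈ L, ∀ v ∈ L, InZp 2 (B u v)

/-- `u · v ∈ ℤ` for all `u, v ∈ L`. -/
def IsIntegral (B : LinearMap.BilinForm ℚ V) (L : Submodule ℤ V) : Prop :=
  ∀ u ∈ L, ∀ v ∈ L, ∃ z : ℤ, B u v = z

/-- The determinant of a lattice: the Gram determinant of a `ℤ`-basis. -/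
noncomputable def latticeDet (B : LinearMap.BilinForm ℚ V) (L : Submodule ℤ V)
    [Submodule.IsLattice ℚ L] : ℚ :=
  (Matrix.of fun i j : Module.Free.ChooseBasisIndex ℤ L =>
    B (Module.Free.chooseBasis ℤ L i : V) (Module.Free.chooseBasis ℤ L j : V)).det

/-- The dual lattice `L^*`: all `v ∈ V` with `v · L ⊆ ℤ`. -/
def dual (B : LinearMap.BilinForm ℚ V) (L : Submodule ℤ V) : Submodule ℤ V :=
  B.dualSubmodule L

/-- The `P`-dual of `L`, for a set `P` of primes: all `v ∈ V` with `v · L ⊆ ℤ_p` for `p ∈ P` and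
`v · L^* ⊆ ℤ_p` for `p ∉ P`. -/
def piDual (B : LinearMap.BilinForm ℚ V) (L : Submodule ℤ V) (P : Set Nat.Primes) :
    Submodule ℤ V where
  carrier := {v | (∀ p ∈ P, ∀ u ∈ L, haveI := Fact.mk p.2; InZp p (B v u)) ∧
    (∀ p ∉ P, ∀ u ∈ dual B L, haveI := Fact.mk p.2; InZp p (B v u))}
  add_mem' := by
    rintro a b ⟨ha, ha'⟩ ⟨hb, hb'⟩
    refine ⟨fun p hp u hu => ?_, fun p hp u hu => ?_⟩
    · have := Fact.mk p.2
      simpa [InZp] using add_mem (ha p hp u hu) (hb p hp u hu)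
    · have := Fact.mk p.2
      simpa [InZp] using add_mem (ha' p hp u hu) (hb' p hp u hu)
  zero_mem' := by
    refine ⟨fun p hp u hu => ?_, fun p hp u hu => ?_⟩ <;>
    · have := Fact.mk p.2
      simp [InZp, zero_mem]
  smul_mem' := by
    rintro c a ⟨ha, ha'⟩
    refine ⟨fun p hp u hu => ?_, fun p hp u hu => ?_⟩
    · have := Fact.mk p.2
      simpa [InZp] using zsmul_mem (ha p hp u hu) c
    · have := Fact.mk p.2
      simpa [InZp] using zsmul_mem (ha' p hp u hu) c

/-- The `P`-level of `L`: the smallest positive integer `l` such that `√l` times the `P`-dual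
of `L` is integral. -/
noncomputable def piLevel (B : LinearMap.BilinForm ℚ V) (L : Submodule ℤ V)
    (P : Set Nat.Primes) : ℕ :=
  sInf {l : ℕ | 0 < l ∧ IsIntegral ((l : ℚ) • B) (piDual B L P)}

/-- A (2-integral) lattice is even if `u · u ∈ 2 ℤ_2` for all `u ∈ L`, and odd otherwise. -/
def IsEven (B : LinearMap.BilinForm ℚ V) (L : Submodule ℤ V) : Prop :=
  ∀ u ∈ L, InTwoZ2 (B u u)

/-- The even sublattice `L₀ = {u ∈ L : u · u ∈ 2 ℤ_2}` (as the subgroup generated by this set;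
for a 2-integral lattice the set is itself a subgroup, see `mem_evenSublattice`). -/
def evenSublattice (B : LinearMap.BilinForm ℚ V) (L : Submodule ℤ V) : Submodule ℤ V :=
  Submodule.span ℤ {u | u ∈ L ∧ InTwoZ2 (B u u)}

theorem mem_evenSublattice {B : LinearMap.BilinForm ℚ V} (hB : B.IsSymm) {L : Submodule ℤ V}
    (hL : IsTwoIntegral B L) (u : V) :
    u ∈ evenSublattice B L ↔ u ∈ L ∧ InTwoZ2 (B u u) := by
  refine ⟨fun hu => ?_, fun hu => Submodule.subset_span hu⟩
  induction hu using Submodule.span_induction with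
  | mem x hx => exact hx
  | zero => exact ⟨zero_mem _, 0, by simp⟩
  | add x y _ _ hx hy =>
    obtain ⟨hx, a, ha⟩ := hx
    obtain ⟨hy, b, hb⟩ := hy
    obtain ⟨c, hc⟩ : ∃ c : ℤ_[2], (B x y : ℚ_[2]) = c := ⟨⟨_, hL x hx y hy⟩, rfl⟩
    refine ⟨add_mem hx hy, a + b + c, ?_⟩
    have hs : B y x = B x y := hB.eq y x
    simp only [map_add, LinearMap.add_apply, Rat.cast_add, ha, hb, hs, hc, PadicInt.coe_add]
    ring
  | smul c x _ hx =>
    obtain ⟨hx, a, ha⟩ := hx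
    refine ⟨Submodule.smul_mem _ c hx, (c : ℤ_[2]) * c * a, ?_⟩
    simp only [map_zsmul, LinearMap.smul_apply, zsmul_eq_mul, Rat.cast_mul, Rat.cast_intCast, ha,
      PadicInt.coe_mul, PadicInt.coe_intCast]
    ring

open Classical in
/-- The shadow of `L`: `L^*` if `L` is even, and `L₀^* \ L^*` if `L` is odd. -/
noncomputable def shadow (B : LinearMap.BilinForm ℚ V) (L : Submodule ℤ V) : Set V :=
  if IsEven B L then (dual B L : Set V)
  else (dual B (evenSublattice B L) : Set V) \ (dual B L : Set V)

/-- The prime `2`. -/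
def two : Nat.Primes := ⟨2, Nat.prime_two⟩

open Classical in
/-- The `P`-shadow of `L`. Write `M` for the `Pᶜ`-dual of `L`. If `2 ∈ P`, it is the shadow of `M`.
If `2 ∉ P`, it is `√l S(√l M)`, where `l` is the 2-level of `L` and `S` denotes the shadow: a vector
of `S(√l M)` is `√l x` with `x ∈ V` in the shadow of `M` for the form `l B`, and then
`√l (√l x) = l x`. -/
noncomputable def piShadow (B : LinearMap.BilinForm ℚ V) (L : Submodule ℤ V)
    (P : Set Nat.Primes) : Set V :=
  if two ∈ P then shadow B (piDual B L Pᶜ)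
  else (fun x : V => (piLevel B L {two} : ℚ) • x) ''
    shadow ((piLevel B L {two} : ℚ) • B) (piDual B L Pᶜ)

end

/-- The odd part of a nonzero rational number `x = 2^k u` (`u` a 2-adic unit), reduced mod 8. -/
def oddPartMod8 (x : ℚ) : ZMod 8 :=
  let u : ℚ := x / 2 ^ padicValRat 2 x
  (u.num : ZMod 8) * (u.den : ZMod 8)⁻¹

/-- `x` is a 2-adic antisquare: `x = 2^k u` with `k` odd and `u ≡ ± 3 (mod 8)`. -/
def IsTwoAntisquare (x : ℚ) : Prop :=
  Odd (padicValRat 2 x) ∧ (oddPartMod8 x = 3 ∨ oddPartMod8 x = -3)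

open Classical in
/-- The oddity of the diagonal form `diag(d₁, …, dₙ)`: the sum of the odd parts of the `dᵢ` plus
four times the number of 2-adic antisquares among them, modulo 8. -/
noncomputable def diagOddity {n : ℕ} (d : Fin n → ℚ) : ZMod 8 :=
  ∑ i, (oddPartMod8 (d i) + if IsTwoAntisquare (d i) then 4 else 0)

/-- `o` is the oddity of the form `B`, hence of every lattice in `V`: it is the oddity of a
diagonalization of `B` over `ℚ`. (For nondegenerate `B` it is independent of the diagonalization.) -/
def IsOddity {V : Type*} [AddCommGroup V] [Module ℚ V] (B : LinearMap.BilinForm ℚ V)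
    (o : ZMod 8) : Prop :=
  ∃ (n : ℕ) (b : Module.Basis (Fin n) ℚ V), (∀ i j, i ≠ j → B (b i) (b j) = 0) ∧
    o = diagOddity fun i => B (b i) (b i)

theorem exists_isOddity {V : Type*} [AddCommGroup V] [Module ℚ V] [FiniteDimensional ℚ V]
    {B : LinearMap.BilinForm ℚ V} (hB : B.IsSymm) : ∃ o, IsOddity B o := by
  obtain ⟨b, hb⟩ := LinearMap.BilinForm.exists_orthogonal_basis (K := ℚ) (B := B) ⟨hB.eq⟩
  exact ⟨_, _, b, fun i j hij => hb hij, rfl⟩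

end Shadow

/-! The proof evaluates one Gauss sum in two ways. Let `e` be the character of `ℚ` with kernel
`ℤ_(2)` and `e (1 / 8) = exp (2πi / 8)` (`twoAdicChar`), let `b` be an orthogonal basis of `V`
rescaled by a large power of `2`, put `Z = ⨁ ℤ_(2) b i`, let `Z#` be the dual of `Z` over `ℤ_(2)`,
and consider `Γ = ∑ e (x · x / 2)` over `x ∈ Z# / Z` (`gaussSum`).

* `Γ` is a product of rank one Gauss sums over `ℤ / 2 ^ m`. Doubling steps reduce these to `m = 1`
  and `m = 2`, and each is a positive real times `e` of one eighth of the corresponding summand of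
  the oddity. Hence `Γ` is a positive multiple of `e (oddity / 8)` (`gaussSum_eq_prod`,
  `prod_gaussSum₁_eq`).
* Let `2 v` be a characteristic vector of `L`, that is `y · y ≡ 2 v · y (mod 2)` for `y ∈ L`. A
  translation by `y ∈ L` does not change `Γ` and multiplies the term of `x` by `e ((x + v) · y)`.
  Averaging over `y` leaves the `x` with `x + v` in the dual of `L`, which at the prime `2` is `L`
  itself because the determinant is odd; for these `x · x ≡ v · v (mod 2)`. Hence `Γ` is a
  nonnegative multiple of `e (v · v / 2)` (`gaussSum_eq_of_characteristic`).

Comparing the two values gives `v · v ≡ oddity / 4 (mod 2 ℤ_2)` (`norm_half_characteristic`), for the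
oddity of any diagonalization.

It remains to see that `2 v` is a characteristic vector of `L` for each `v` in the `P`-shadow. At the
prime `2` all `P`-duals of `L` agree with `L`: each vector of one has an odd multiple in the other
(`exists_odd_smul_mem_of_mem_piDual`, `exists_odd_smul_mem_piDual`). Twice a vector of an ordinary
shadow is characteristic (`characteristic_of_mem_shadow`), and the rescaling by the `2`-level is
harmless since the `2`-level is odd (`odd_piLevel_two`). -/

namespace Shadow

/-! ### Rational numbers integral at two -/

theorem inZp_iff (p : ℕ) [hp : Fact p.Prime] (q : ℚ) : InZp p q ↔ ¬ p ∣ q.den := by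
  rw [InZp, PadicInt.mem_subring_iff, Padic.norm_rat_le_one_iff_padicValuation_le_one,
    Rat.padicValuation_le_one_iff]

/-- The ring `ℤ_(2) = ℚ ∩ ℤ_2` of rational numbers with odd denominator. -/
noncomputable def Z2 : Subring ℚ := (PadicInt.subring 2).comap (Rat.castHom ℚ_[2])

theorem inZp_two_iff {q : ℚ} : InZp 2 q ↔ q ∈ Z2 := Iff.rfl

theorem mem_Z2_iff {q : ℚ} : q ∈ Z2 ↔ Odd q.den := by
  rw [← inZp_two_iff, inZp_iff, ← Nat.not_even_iff_odd, even_iff_two_dvd]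

theorem inTwoZ2_iff {q : ℚ} : InTwoZ2 q ↔ q / 2 ∈ Z2 := by
  constructor
  · rintro ⟨z, hz⟩
    have : ((q / 2 : ℚ) : ℚ_[2]) = z := by push_cast; rw [hz]; field_simp
    exact show ((q / 2 : ℚ) : ℚ_[2]) ∈ PadicInt.subring 2 from this ▸ z.2
  · intro h
    refine ⟨⟨((q / 2 : ℚ) : ℚ_[2]), h⟩, ?_⟩
    push_cast
    field_simp

theorem int_mem_Z2 (n : ℤ) : (n : ℚ) ∈ Z2 := intCast_mem _ n

theorem nat_mem_Z2 (n : ℕ) : (n : ℚ) ∈ Z2 := natCast_mem _ n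

theorem inv_mem_Z2 {n : ℤ} (hn : Odd n) : (n : ℚ)⁻¹ ∈ Z2 := by
  rw [mem_Z2_iff, Rat.inv_intCast_den]
  split_ifs with h
  · exact odd_one
  · exact Int.natAbs_odd.2 hn

theorem mem_Z2_of_odd_mul {n : ℤ} (hn : Odd n) {q : ℚ} (h : n * q ∈ Z2) : q ∈ Z2 := by
  have hn0 : (n : ℚ) ≠ 0 := by
    rintro h0
    rw [Int.cast_eq_zero] at h0
    simp [h0] at hn
  simpa [hn0] using mul_mem (inv_mem_Z2 hn) h

theorem intCast_div_mem_Z2_iff {a : ℤ} {m : ℕ} : (a : ℚ) / 2 ^ m ∈ Z2 ↔ (2 : ℤ) ^ m ∣ a := by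
  constructor
  · intro h
    rw [mem_Z2_iff] at h
    set q := (a : ℚ) / 2 ^ m with hq
    have h1 : a * q.den = 2 ^ m * q.num := by
      have h2 : q * q.den = q.num := Rat.mul_den_eq_num q
      have h3 : (a : ℚ) = q * 2 ^ m := by rw [hq]; field_simp
      have h4 : (a : ℚ) * q.den = 2 ^ m * q.num := by rw [h3, ← h2]; ring
      exact_mod_cast h4
    have hc : IsCoprime ((2 : ℤ) ^ m) (q.den : ℤ) := by
      refine IsCoprime.pow_left ?_
      rw [Int.isCoprime_iff_gcd_eq_one]
      exact (Nat.coprime_two_left).2 h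
    exact hc.dvd_of_dvd_mul_right ⟨_, h1⟩
  · rintro ⟨b, rfl⟩
    push_cast
    rw [mul_div_cancel_left₀ _ (by positivity)]
    exact int_mem_Z2 b

theorem exists_int_sub_div_mem_Z2 {r : ℚ} (hr : r ∈ Z2) (m : ℕ) :
    ∃ a : ℤ, (r - a) / 2 ^ m ∈ Z2 := by
  rw [mem_Z2_iff] at hr
  have hc : IsCoprime ((2 : ℤ) ^ m) (r.den : ℤ) := by
    refine IsCoprime.pow_left ?_
    rw [Int.isCoprime_iff_gcd_eq_one]
    exact (Nat.coprime_two_left).2 hr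
  obtain ⟨x, y, hxy⟩ := hc
  refine ⟨r.num * y, mem_Z2_of_odd_mul (n := r.den) (by exact_mod_cast hr) ?_⟩
  have h2 : r * r.den = r.num := Rat.mul_den_eq_num r
  have hxy' : (x : ℚ) * 2 ^ m + y * r.den = 1 := by exact_mod_cast hxy
  have : ((r.den : ℤ) : ℚ) * ((r - ((r.num * y : ℤ) : ℚ)) / 2 ^ m) = ((r.num * x : ℤ) : ℚ) := by
    push_cast
    field_simp
    linear_combination h2 - (r.num : ℚ) * hxy'
  rw [this]
  exact int_mem_Z2 _

theorem exists_pow_two_mul_mem_Z2 (q : ℚ) : ∃ N : ℕ, ∀ k, N ≤ k → 2 ^ k * q ∈ Z2 := by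
  obtain ⟨N, m, hm, h⟩ := Nat.exists_eq_two_pow_mul_odd q.den_nz
  refine ⟨N, fun k hk => mem_Z2_of_odd_mul (n := m) (by exact_mod_cast hm) ?_⟩
  obtain ⟨j, rfl⟩ := Nat.exists_eq_add_of_le hk
  have h2 : q * q.den = q.num := Rat.mul_den_eq_num q
  rw [h] at h2
  have : ((m : ℤ) : ℚ) * (2 ^ (N + j) * q) = ((2 ^ j * q.num : ℤ) : ℚ) := by
    push_cast at h2 ⊢
    rw [← h2]
    ring
  rw [this]
  exact int_mem_Z2 _

theorem exists_pow_two_mul_mem_Z2_of_finite {α : Type*} [Finite α] (q : α → ℚ) :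
    ∃ N : ℕ, ∀ k, N ≤ k → ∀ a, 2 ^ k * q a ∈ Z2 := by
  choose N hN using fun a => exists_pow_two_mul_mem_Z2 (q a)
  obtain ⟨M, hM⟩ := (Set.finite_range N).bddAbove
  exact ⟨M, fun k hk a => hN a k ((hM ⟨a, rfl⟩).trans hk)⟩

theorem exists_odd_mul_eq_int {α : Type*} [Finite α] (q : α → ℚ) (hq : ∀ a, q a ∈ Z2) :
    ∃ n : ℤ, Odd n ∧ ∀ a, ∃ z : ℤ, n * q a = z := by
  have := Fintype.ofFinite α
  refine ⟨∏ a, ((q a).den : ℤ), ?_, fun a => ?_⟩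
  · exact Finset.prod_induction _ _ (fun _ _ => Odd.mul) odd_one
      fun a _ => by exact_mod_cast mem_Z2_iff.1 (hq a)
  · obtain ⟨c, hc⟩ := Finset.dvd_prod_of_mem (fun a => ((q a).den : ℤ)) (Finset.mem_univ a)
    refine ⟨c * (q a).num, ?_⟩
    rw [hc]
    push_cast
    rw [← Rat.mul_den_eq_num (q a)]
    ring

theorem exists_int_of_forall_inZp {q : ℚ} (h : ∀ p : Nat.Primes, haveI := Fact.mk p.2; InZp p q) :
    ∃ z : ℤ, q = z := by
  refine ⟨q.num, ((Rat.den_eq_one_iff q).1 ?_).symm⟩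
  by_contra hd
  obtain ⟨p, hp, hpd⟩ := Nat.exists_prime_and_dvd hd
  have := Fact.mk hp
  exact (inZp_iff p q).1 (h ⟨p, hp⟩) hpd

theorem int_inZp (p : ℕ) [Fact p.Prime] (z : ℤ) : InZp p z := by
  simp [InZp, intCast_mem]

/-! ### A character of `ℚ` with kernel `ℤ_(2)` -/

theorem exists_twoAdicChar : ∃ e : AddChar ℚ ℂ, (∀ q ∈ Z2, e q = 1) ∧
    e (1 / 8) = ZMod.stdAddChar (N := 8) 1 := by
  -- extend the standard character of `ℤ / 8 ≅ (1 / 8) ℤ / ℤ` to `ℚ ⧸ ℤ_(2)`, as `ℝ / ℤ` is injective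
  let φ : ℤ →+ ℚ ⧸ Z2.toAddSubgroup :=
    (QuotientAddGroup.mk' Z2.toAddSubgroup).comp
      ((AddMonoidHom.mulLeft (1 / 8 : ℚ)).comp (Int.castAddHom ℚ))
  have hφ : ∀ a : ℤ, φ a = 0 ↔ (8 : ℤ) ∣ a := by
    intro a
    have : φ a = QuotientAddGroup.mk ((1 / 8 : ℚ) * a) := rfl
    rw [this, QuotientAddGroup.eq_zero_iff]
    have := intCast_div_mem_Z2_iff (a := a) (m := 3)
    norm_num at this
    rw [← this, Subring.mem_toAddSubgroup]
    ring_nf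
  let f : ZMod 8 →+ ℚ ⧸ Z2.toAddSubgroup := ZMod.lift 8 ⟨φ, (hφ _).2 (by norm_num)⟩
  have hf : Function.Injective f := by
    rw [ZMod.lift_injective]
    intro m hm
    rw [ZMod.intCast_zmod_eq_zero_iff_dvd]
    exact (hφ m).1 hm
  obtain ⟨h, hh⟩ := (Module.Baer.of_divisible (AddCircle (1 : ℝ))).extension_property_addMonoidHom
    f hf (ZMod.toAddCircle (N := 8))
  let g : ℚ →+ AddCircle (1 : ℝ) := h.comp (QuotientAddGroup.mk' Z2.toAddSubgroup)
  refine ⟨⟨fun q => (AddCircle.toCircle (g q) : ℂ), by simp, fun a b => by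
    simp [AddCircle.toCircle_add]⟩, fun q hq => ?_, ?_⟩
  · have : g q = 0 := by
      change h (QuotientAddGroup.mk q) = 0
      rw [(QuotientAddGroup.eq_zero_iff q).2 hq, map_zero]
    simp [this]
  · have h1 : g (1 / 8) = ZMod.toAddCircle (N := 8) 1 := by
      rw [← hh]
      change h (QuotientAddGroup.mk (1 / 8)) = h (f 1)
      have : f ((1 : ℤ) : ZMod 8) = φ 1 := ZMod.lift_coe _ _ _
      rw [Int.cast_one] at this
      rw [this]
      simp [φ]
    simp only [AddChar.coe_mk, h1]
    rfl

/-- A character of `ℚ` trivial on `ℤ_(2)`, normalized by `1 / 8 ↦ exp (2πi / 8)`. It plays the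
role of `q ↦ exp (2πi {q})`, with `{q}` the `2`-adic fractional part; the only property needed
beyond the normalization is that its kernel is exactly `ℤ_(2)`, see `twoAdicChar_eq_one_iff`. -/
noncomputable def twoAdicChar : AddChar ℚ ℂ := exists_twoAdicChar.choose

theorem twoAdicChar_eq_one {q : ℚ} (h : q ∈ Z2) : twoAdicChar q = 1 :=
  exists_twoAdicChar.choose_spec.1 q h

theorem twoAdicChar_congr {q r : ℚ} (h : q - r ∈ Z2) : twoAdicChar q = twoAdicChar r := by
  have : q = (q - r) + r := by ring
  rw [this, AddChar.map_add_eq_mul, twoAdicChar_eq_one h, one_mul]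

theorem twoAdicChar_int_div_eight (a : ℤ) :
    twoAdicChar (a / 8) = ZMod.stdAddChar (N := 8) a := by
  have h := exists_twoAdicChar.choose_spec.2
  have h1 : (a / 8 : ℚ) = a • (1 / 8 : ℚ) := by rw [zsmul_eq_mul]; ring
  have h2 : (a : ZMod 8) = a • (1 : ZMod 8) := by simp
  rw [h1, h2, AddChar.map_zsmul_eq_zpow, AddChar.map_zsmul_eq_zpow]
  exact congrArg (· ^ a) h

theorem twoAdicChar_eq_one_iff {q : ℚ} : twoAdicChar q = 1 ↔ q ∈ Z2 := by
  refine ⟨fun h => ?_, twoAdicChar_eq_one⟩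
  by_contra hq
  -- a multiple of `q` by a power of two is congruent to `1 / 2`, where the character is nontrivial
  obtain ⟨N, hN⟩ := exists_pow_two_mul_mem_Z2 q
  classical
  have hex : ∃ N : ℕ, 2 ^ N * q ∈ Z2 := ⟨N, hN N le_rfl⟩
  obtain ⟨k, hk⟩ : ∃ k, Nat.find hex = k + 1 := Nat.exists_eq_succ_of_ne_zero fun h0 => by
    have := Nat.find_spec hex
    rw [h0] at this
    simp [hq] at this
  have h1 : 2 ^ (k + 1) * q ∈ Z2 := hk ▸ Nat.find_spec hex
  have h2 : 2 ^ k * q ∉ Z2 := Nat.find_min hex (by omega)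
  obtain ⟨a, ha⟩ := exists_int_sub_div_mem_Z2 h1 1
  have ha' : 2 ^ k * q - (4 * a : ℤ) / 8 ∈ Z2 := by
    convert ha using 1
    push_cast
    ring
  have h3 : twoAdicChar (2 ^ k * q) = 1 := by
    have : (2 ^ k * q : ℚ) = (2 ^ k : ℕ) • q := by rw [nsmul_eq_mul]; push_cast; ring
    rw [this, AddChar.map_nsmul_eq_pow, h, one_pow]
  rw [twoAdicChar_congr ha', twoAdicChar_int_div_eight, ← AddChar.map_zero_eq_one
    (ZMod.stdAddChar (N := 8))] at h3
  have h4 := (ZMod.intCast_zmod_eq_zero_iff_dvd _ 8).1 (ZMod.injective_stdAddChar h3)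
  obtain ⟨b, hb⟩ : (2 : ℤ) ∣ a := by push_cast at h4; omega
  apply h2
  have h5 := add_mem ha' (int_mem_Z2 b)
  convert h5 using 1
  rw [hb]
  push_cast
  ring

theorem norm_twoAdicChar (q : ℚ) : ‖twoAdicChar q‖ = 1 := by
  obtain ⟨N, hN⟩ := exists_pow_two_mul_mem_Z2 q
  have h : twoAdicChar q ^ (2 ^ N) = 1 := by
    rw [← AddChar.map_nsmul_eq_pow]
    refine twoAdicChar_eq_one ?_
    rw [nsmul_eq_mul]
    exact_mod_cast hN N le_rfl
  exact Complex.norm_eq_one_of_pow_eq_one h (by positivity)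

/-! ### Rank one Gauss sums -/

theorem sum_range_two_mul {M : Type*} [AddCommMonoid M] (g : ℕ → M) (n : ℕ) :
    ∑ x ∈ Finset.range (2 * n), g x = ∑ y ∈ Finset.range n, (g (2 * y) + g (2 * y + 1)) := by
  induction n with
  | zero => simp
  | succ n ih =>
    rw [Finset.sum_range_succ, ← ih, show 2 * (n + 1) = 2 * n + 1 + 1 by ring,
      Finset.sum_range_succ, Finset.sum_range_succ, add_assoc]

/-- The Gauss sum of the rank one form `u x²` on `ℤ / 2^m`. -/
noncomputable def gaussSum₁ (m : ℕ) (u : ℚ) : ℂ :=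
  ∑ j ∈ Finset.range (2 ^ m), twoAdicChar (u * j ^ 2 / 2 ^ (m + 1))

theorem twoAdicChar_eq_stdAddChar {r : ℚ} {a : ℤ} (h : (r - a) / 2 ^ 3 ∈ Z2) (n : ℤ) :
    twoAdicChar (n * r / 8) = ZMod.stdAddChar (N := 8) (n * a) := by
  have h1 : n * r / 8 - (n * a : ℤ) / 8 ∈ Z2 := by
    convert mul_mem (int_mem_Z2 n) h using 1
    push_cast
    ring
  rw [twoAdicChar_congr h1, twoAdicChar_int_div_eight]
  push_cast
  rfl

theorem stdAddChar_four : ZMod.stdAddChar (N := 8) 4 = -1 := by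
  have := ZMod.stdAddChar_coe (N := 8) 4
  push_cast at this
  rw [this, show 2 * (Real.pi : ℂ) * Complex.I * 4 / 8 = Real.pi * Complex.I by ring,
    Complex.exp_pi_mul_I]

/-- Adding the terms of `x` and `x + 2 ^ (m + 1)` kills those with `x` odd and doubles the others,
so that the substitution `x = 2 y` gives the sum for `m`. -/
theorem gaussSum₁_add_two {u : ℚ} (hu : u ∈ Z2) (hu' : (u - 1) / 2 ∈ Z2) {m : ℕ} (hm : 1 ≤ m) :
    gaussSum₁ (m + 2) u = 2 * gaussSum₁ m u := by
  obtain ⟨k, rfl⟩ := Nat.exists_eq_add_of_le' hm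
  have hhalf : twoAdicChar (u / 2) = -1 := by
    have h1 : u / 2 - (4 : ℤ) / 8 ∈ Z2 := by
      convert hu' using 1
      push_cast
      ring
    rw [twoAdicChar_congr h1, twoAdicChar_int_div_eight]
    exact_mod_cast stdAddChar_four
  have h1 : gaussSum₁ (k + 1 + 2) u = ∑ x ∈ Finset.range (2 ^ (k + 2)),
      twoAdicChar (u * x ^ 2 / 2 ^ (k + 4)) * (1 + twoAdicChar (u * x / 2)) := by
    rw [gaussSum₁, show 2 ^ (k + 1 + 2) = 2 ^ (k + 2) + 2 ^ (k + 2) by ring,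
      Finset.sum_range_add, ← Finset.sum_add_distrib]
    refine Finset.sum_congr rfl fun x _ => ?_
    rw [mul_add, mul_one, ← AddChar.map_add_eq_mul]
    congr 1
    apply twoAdicChar_congr
    convert mul_mem hu (nat_mem_Z2 (2 ^ k)) using 1
    push_cast
    field_simp
    ring
  rw [h1, show 2 ^ (k + 2) = 2 * 2 ^ (k + 1) by ring, sum_range_two_mul, gaussSum₁, Finset.mul_sum]
  refine Finset.sum_congr rfl fun y _ => ?_
  have h2 : twoAdicChar (u * (2 * y : ℕ) / 2) = 1 := by
    apply twoAdicChar_eq_one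
    convert mul_mem hu (nat_mem_Z2 y) using 1
    push_cast
    ring
  have h3 : twoAdicChar (u * (2 * y + 1 : ℕ) / 2) = -1 := by
    rw [← hhalf]
    apply twoAdicChar_congr
    convert mul_mem hu (nat_mem_Z2 y) using 1
    push_cast
    ring
  rw [h2, h3]
  have h4 : (u * (2 * y : ℕ) ^ 2 / 2 ^ (k + 4) : ℚ) = u * y ^ 2 / 2 ^ (k + 1 + 1) := by
    push_cast
    field_simp
    ring
  rw [h4]
  ring

theorem stdAddChar_one : ZMod.stdAddChar (N := 8) 1 = (√2 / 2 : ℝ) * (1 + Complex.I) := by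
  have := ZMod.stdAddChar_coe (N := 8) 1
  push_cast at this
  rw [this, show 2 * (Real.pi : ℂ) * Complex.I * 1 / 8 = ((Real.pi / 4 : ℝ) : ℂ) * Complex.I by
    push_cast; ring, Complex.exp_mul_I, ← Complex.ofReal_cos, ← Complex.ofReal_sin,
    Real.cos_pi_div_four, Real.sin_pi_div_four]
  ring

/-- The phase of a rank one Gauss sum is the contribution of the form to the oddity. -/
theorem gaussSum₁_eq {u : ℚ} (hu : u ∈ Z2) {a : ℤ} (ha : (u - a) / 2 ^ 3 ∈ Z2) (hodd : Odd a)
    {m : ℕ} (hm : 1 ≤ m) : ∃ c : ℝ, 0 < c ∧ gaussSum₁ m u =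
      c * ZMod.stdAddChar (N := 8) (a + if Odd m ∧ ((a : ZMod 8) = 3 ∨ (a : ZMod 8) = -3)
        then 4 else 0) := by
  induction m using Nat.strong_induction_on with
  | _ m ih =>
  have hu' : (u - 1) / 2 ∈ Z2 := by
    obtain ⟨b, rfl⟩ := hodd
    convert add_mem (mul_mem ha (int_mem_Z2 4)) (int_mem_Z2 b) using 1
    push_cast
    ring
  obtain rfl | rfl | h3 : m = 1 ∨ m = 2 ∨ 3 ≤ m := by omega
  -- `1 + e (u / 4) = 1 ± I = √2 exp (± 2πi / 8)`, with the sign of `u` modulo 4: the summand 4 for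
  -- `u ≡ ± 3` replaces 3 by 7 and 5 by 1
  · refine ⟨√2, by positivity, ?_⟩
    have h0 : gaussSum₁ 1 u = 1 + ZMod.stdAddChar (N := 8) (2 * a) := by
      have := twoAdicChar_eq_stdAddChar ha 2
      push_cast at this
      rw [← this]
      simp only [gaussSum₁, Finset.sum_range_succ, pow_one, Finset.sum_range_zero]
      norm_num
      congr 1
      ring
    rw [h0]
    have hs : ((√2 : ℝ) : ℂ) ^ 2 = 2 := by
      rw [← Complex.ofReal_pow, Real.sq_sqrt (by norm_num)]; norm_num
    have hI := Complex.I_sq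
    have key : ∀ n : ℕ, ZMod.stdAddChar (N := 8) (n : ZMod 8)
        = ((√2 / 2 : ℝ) * (1 + Complex.I)) ^ n := by
      intro n
      rw [← stdAddChar_one, ← AddChar.map_nsmul_eq_pow]
      simp
    have hcases : (a : ZMod 8) = 1 ∨ (a : ZMod 8) = 3 ∨ (a : ZMod 8) = 5 ∨ (a : ZMod 8) = 7 := by
      obtain ⟨b, rfl⟩ := hodd
      push_cast
      generalize (b : ZMod 8) = b
      revert b
      decide
    have k1 := key 1
    have k2 := key 2
    have k7 := key 7
    have k6 := key 6
    have e2 : ((√2 / 2 : ℝ) * (1 + Complex.I)) ^ 2 = Complex.I := by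
      push_cast
      linear_combination (1 + Complex.I) ^ 2 / 4 * hs + hI / 2
    have e6 : ((√2 / 2 : ℝ) * (1 + Complex.I)) ^ 6 = -Complex.I := by
      rw [show 6 = 2 * 3 by norm_num, pow_mul, e2, pow_succ, hI]; ring
    have e7 : ((√2 / 2 : ℝ) * (1 + Complex.I)) ^ 7 = (√2 / 2 : ℝ) * (1 - Complex.I) := by
      rw [pow_succ, e6]
      linear_combination (-(√2 / 2 : ℝ) : ℂ) * hI
    rw [e2] at k2
    rw [e6] at k6
    rw [e7] at k7
    rw [pow_one] at k1
    push_cast at k1 k2 k6 k7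
    have f1 : 1 + Complex.I = √2 * (√2 / 2 * (1 + Complex.I)) := by
      linear_combination -(1 + Complex.I) / 2 * hs
    have f2 : 1 + -Complex.I = √2 * (√2 / 2 * (1 - Complex.I)) := by
      linear_combination -(1 - Complex.I) / 2 * hs
    rcases hcases with h | h | h | h <;> rw [h]
    · rw [if_neg (by decide), show (2 * 1 : ZMod 8) = 2 by decide, add_zero, k1, k2, ← f1]
    · rw [if_pos (by decide), show (2 * 3 : ZMod 8) = 6 by decide,
        show (3 + 4 : ZMod 8) = 7 by decide, k6, k7, f2]
    · rw [if_pos (by decide), show (2 * 5 : ZMod 8) = 2 by decide,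
        show (5 + 4 : ZMod 8) = 1 by decide, k1, k2, ← f1]
    · rw [if_neg (by decide), show (2 * 7 : ZMod 8) = 6 by decide, add_zero, k6, k7, f2]
  -- `1 + e (u / 8) + e (u / 2) + e (9 u / 8) = 2 e (u / 8)`
  · refine ⟨2, by norm_num, ?_⟩
    have h1 := twoAdicChar_eq_stdAddChar ha 1
    have h4 := twoAdicChar_eq_stdAddChar ha 4
    have h9 := twoAdicChar_eq_stdAddChar ha 9
    push_cast at h1 h4 h9
    have e4 : (4 * a : ZMod 8) = 4 := by
      obtain ⟨b, rfl⟩ := hodd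
      push_cast
      generalize (b : ZMod 8) = b
      revert b
      decide
    have e9 : (9 * a : ZMod 8) = a := by
      rw [show (9 : ZMod 8) = 1 by decide, one_mul]
    rw [e4, stdAddChar_four] at h4
    rw [e9] at h9
    rw [one_mul (a : ZMod 8)] at h1
    have h0 : gaussSum₁ 2 u = 1 + twoAdicChar (1 * u / 8) + twoAdicChar (4 * u / 8)
        + twoAdicChar (9 * u / 8) := by
      rw [gaussSum₁, show 2 ^ 2 = 4 by norm_num]
      simp only [Finset.sum_range_succ, Finset.sum_range_zero]
      norm_num [mul_comm]
    rw [if_neg (fun h => absurd h.1 (by decide)), add_zero, h0, h4, h9, h1]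
    push_cast
    ring
  · obtain ⟨k, rfl⟩ := Nat.exists_eq_add_of_le' h3
    obtain ⟨c, hc, h⟩ := ih (k + 1) (by omega) (by omega)
    refine ⟨2 * c, by positivity, ?_⟩
    rw [show k + 3 = k + 1 + 2 by ring, gaussSum₁_add_two hu hu' (by omega), h]
    have : Odd (k + 1 + 2) ↔ Odd (k + 1) := by
      rw [Nat.odd_add]; simp
    simp only [this]
    push_cast
    ring

theorem padicValRat_two_zpow (k : ℤ) : padicValRat 2 (2 ^ k) = k := by
  have h2 := padicValRat.self (p := 2) (by norm_num)
  push_cast at h2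
  rw [padicValRat.zpow, h2, mul_one]

/-- The odd part of `d ≠ 0` is a `2`-adic unit, and `oddPartMod8 d` is its class modulo 8. -/
theorem exists_odd_sub_oddPart_div {d : ℚ} (hd : d ≠ 0) :
    d / 2 ^ padicValRat 2 d ∈ Z2 ∧ ∃ a : ℤ, Odd a ∧
      (d / 2 ^ padicValRat 2 d - a) / 2 ^ 3 ∈ Z2 ∧ oddPartMod8 d = a := by
  set u := d / 2 ^ padicValRat 2 d with hu
  have hu0 : u ≠ 0 := div_ne_zero hd (by positivity)
  have hval : padicValRat 2 u = 0 := by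
    rw [hu, padicValRat.div hd (by positivity), padicValRat_two_zpow, sub_self]
  rw [padicValRat_def] at hval
  have hcop := u.reduced
  have hnum0 : u.num ≠ 0 := Rat.num_ne_zero.2 hu0
  have hnum : ¬ 2 ∣ u.num.natAbs := by
    intro h
    have h1 : ¬ 2 ∣ u.den := fun h' => by
      have := Nat.dvd_gcd h h'
      rw [hcop.gcd_eq_one] at this
      omega
    have h2 := padicValNat.eq_zero_of_not_dvd h1
    have h3 : 1 ≤ padicValNat 2 u.num.natAbs := one_le_padicValNat_of_dvd (by simpa using hnum0) h
    rw [h2, padicValInt] at hval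
    omega
  have hden : ¬ 2 ∣ u.den := by
    intro h
    have h2 := padicValNat.eq_zero_of_not_dvd hnum
    have h3 : 1 ≤ padicValNat 2 u.den := one_le_padicValNat_of_dvd u.den_nz h
    rw [padicValInt, h2] at hval
    omega
  have hmem : u ∈ Z2 := mem_Z2_iff.2 (by rwa [← Nat.not_even_iff_odd, even_iff_two_dvd])
  obtain ⟨a, ha⟩ := exists_int_sub_div_mem_Z2 hmem 3
  have hcong : (2 : ℤ) ^ 3 ∣ u.num - a * u.den := by
    rw [← intCast_div_mem_Z2_iff]
    convert mul_mem ha (nat_mem_Z2 u.den) using 1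
    push_cast
    rw [← Rat.mul_den_eq_num u]
    ring
  refine ⟨hmem, a, ?_, ha, ?_⟩
  · rw [← Int.not_even_iff_odd, even_iff_two_dvd]
    intro h
    apply hnum
    rw [← Int.natCast_dvd]
    have h8 : (2 : ℤ) ∣ u.num - a * u.den := dvd_trans (by norm_num) hcong
    have := dvd_add h8 (h.mul_right u.den)
    simpa using this
  · change (u.num : ZMod 8) * (u.den : ZMod 8)⁻¹ = a
    have h1 : ((u.num : ℤ) : ZMod 8) = a * u.den := by
      have := (ZMod.intCast_zmod_eq_zero_iff_dvd (u.num - a * u.den) 8).2 (by simpa using hcong)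
      push_cast at this
      exact sub_eq_zero.1 this
    have h2 : Nat.Coprime u.den 8 := by
      rw [show 8 = 2 ^ 3 by norm_num]
      exact Nat.Coprime.pow_right 3 ((Nat.coprime_comm.1
        ((Nat.Prime.coprime_iff_not_dvd Nat.prime_two).2 hden)))
    rw [h1, mul_assoc, ZMod.coe_mul_inv_eq_one _ h2, mul_one]

theorem addChar_map_sum {A ι : Type*} [AddCommGroup A] (ψ : AddChar A ℂ) (s : Finset ι)
    (f : ι → A) : ψ (∑ i ∈ s, f i) = ∏ i ∈ s, ψ (f i) := by
  classical
  induction s using Finset.induction_on with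
  | empty => simp
  | insert a s ha ih => rw [Finset.sum_insert ha, Finset.prod_insert ha, ψ.map_add_eq_mul, ih]

/-- The phase of a diagonal Gauss sum is the oddity. The hypothesis on `m` says that the entries `d i`
have been multiplied by `4 ^ k`, which affects neither odd parts nor antisquares. -/
theorem prod_gaussSum₁_eq {n : ℕ} {d : Fin n → ℚ} (hd : ∀ i, d i ≠ 0) {m : Fin n → ℕ} {k : ℕ}
    (hm : ∀ i, 1 ≤ m i) (hmk : ∀ i, (m i : ℤ) = padicValRat 2 (d i) + 2 * k) :
    ∃ c : ℝ, 0 < c ∧ ∏ i, gaussSum₁ (m i) (d i / 2 ^ padicValRat 2 (d i)) =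
      c * ZMod.stdAddChar (N := 8) (diagOddity d) := by
  have key : ∀ i, ∃ c : ℝ, 0 < c ∧ gaussSum₁ (m i) (d i / 2 ^ padicValRat 2 (d i)) =
      c * ZMod.stdAddChar (N := 8) (oddPartMod8 (d i) +
        open Classical in if IsTwoAntisquare (d i) then 4 else 0) := by
    intro i
    obtain ⟨hu, a, hodd, ha, h8⟩ := exists_odd_sub_oddPart_div (hd i)
    obtain ⟨c, hc, h⟩ := gaussSum₁_eq hu ha hodd (hm i)
    refine ⟨c, hc, ?_⟩
    have : Odd (m i) ↔ Odd (padicValRat 2 (d i)) := by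
      rw [← Int.odd_coe_nat, hmk, Int.odd_add]
      simp
    rw [h, h8]
    simp only [IsTwoAntisquare, h8, this]
  choose c hc h using key
  refine ⟨∏ i, c i, Finset.prod_pos fun i _ => hc i, ?_⟩
  rw [Finset.prod_congr rfl fun i _ => h i, Finset.prod_mul_distrib, diagOddity,
    addChar_map_sum]
  push_cast
  rfl

/-! ### Gauss sums of diagonal forms -/

theorem sum_range_pow_two_twoAdicChar {q : ℚ} {N : ℕ} (hN : 2 ^ N * q ∈ Z2) [Decidable (q ∈ Z2)] :
    ∑ k ∈ Finset.range (2 ^ N), twoAdicChar (k * q) = if q ∈ Z2 then 2 ^ N else 0 := by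
  have hpow : ∀ k : ℕ, twoAdicChar (k * q) = twoAdicChar q ^ k := by
    intro k
    rw [← AddChar.map_nsmul_eq_pow, nsmul_eq_mul]
  simp_rw [hpow]
  split_ifs with h
  · simp [twoAdicChar_eq_one h]
  · have h1 : twoAdicChar q ≠ 1 := fun h1 => h (twoAdicChar_eq_one_iff.1 h1)
    rw [geom_sum_eq h1, ← hpow, twoAdicChar_eq_one (by exact_mod_cast hN), sub_self, zero_div]

section

variable {V : Type*} [AddCommGroup V] [Module ℚ V]

theorem bilin_eq_sum_of_orthogonal (B : LinearMap.BilinForm ℚ V) {n : ℕ}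
    (b : Module.Basis (Fin n) ℚ V) (hb : ∀ i j, i ≠ j → B (b i) (b j) = 0) (x y : V) :
    B x y = ∑ i, b.repr x i * b.repr y i * B (b i) (b i) := by
  conv_lhs => rw [← b.sum_repr x, ← b.sum_repr y]
  simp only [map_sum, LinearMap.sum_apply, map_smul, LinearMap.smul_apply, smul_eq_mul]
  refine Finset.sum_congr rfl fun i _ => ?_
  rw [Finset.sum_eq_single i (fun j _ hj => by rw [hb j i hj]; ring) (by simp)]
  ring

theorem twoAdicChar_half_add {B : LinearMap.BilinForm ℚ V} (hB : B.IsSymm) (x y : V) :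
    twoAdicChar (B (x + y) (x + y) / 2) =
      twoAdicChar (B x x / 2) * twoAdicChar (B x y + B y y / 2) := by
  rw [← AddChar.map_add_eq_mul]
  congr 1
  have : B y x = B x y := hB.eq y x
  simp only [map_add, LinearMap.add_apply, this]
  ring

/-- For an orthogonal basis `b` with `b i · b i = 2 ^ m i * u i`, the vectors `cosetRep b m j`
represent the cosets of `⨁ ℤ_(2) b i` in `⨁ 2 ^ (- m i) ℤ_(2) b i`, which is the `2`-dual when all
the `u i` are units. -/
noncomputable def cosetRep {n : ℕ} (b : Module.Basis (Fin n) ℚ V) (m : Fin n → ℕ)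
    (j : ∀ i, ZMod (2 ^ m i)) : V :=
  ∑ i, ((j i).val / 2 ^ m i : ℚ) • b i

theorem repr_cosetRep {n : ℕ} (b : Module.Basis (Fin n) ℚ V) (m : Fin n → ℕ)
    (j : ∀ i, ZMod (2 ^ m i)) (i : Fin n) :
    b.repr (cosetRep b m j) i = (j i).val / 2 ^ m i := by
  rw [cosetRep, b.repr_sum_self]

/-- The Gauss sum of the diagonal form, over the discriminant group of `⨁ ℤ_(2) b i`. -/
noncomputable def gaussSum (B : LinearMap.BilinForm ℚ V) {n : ℕ} (b : Module.Basis (Fin n) ℚ V)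
    (m : Fin n → ℕ) : ℂ :=
  ∑ j : ∀ i, ZMod (2 ^ m i), twoAdicChar (B (cosetRep b m j) (cosetRep b m j) / 2)

variable {B : LinearMap.BilinForm ℚ V} {n : ℕ} {b : Module.Basis (Fin n) ℚ V}
  {m : Fin n → ℕ} {u : Fin n → ℚ}

theorem gaussSum_eq_prod (hb : ∀ i j, i ≠ j → B (b i) (b j) = 0)
    (hu : ∀ i, B (b i) (b i) = 2 ^ m i * u i) :
    gaussSum B b m = ∏ i, gaussSum₁ (m i) (u i) := by
  have h1 : ∀ i, gaussSum₁ (m i) (u i) =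
      ∑ j : ZMod (2 ^ m i), twoAdicChar (u i * j.val ^ 2 / 2 ^ (m i + 1)) := by
    intro i
    rw [gaussSum₁]
    symm
    refine Finset.sum_bij (fun j _ => j.val) (fun j _ => Finset.mem_range.2 (ZMod.val_lt j))
      (fun j _ k _ h => ZMod.val_injective _ h) (fun k hk => ⟨k, Finset.mem_univ _, ?_⟩)
      (fun _ _ => rfl)
    exact ZMod.val_cast_of_lt (Finset.mem_range.1 hk)
  simp_rw [h1]
  rw [Finset.prod_univ_sum, Fintype.piFinset_univ, gaussSum]
  refine Finset.sum_congr rfl fun j _ => ?_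
  rw [← addChar_map_sum, bilin_eq_sum_of_orthogonal B b hb, Finset.sum_div]
  congr 1
  refine Finset.sum_congr rfl fun i _ => ?_
  rw [repr_cosetRep, hu]
  field_simp
  ring

/-- Translating all coset representatives by a vector of the larger lattice permutes the cosets. -/
theorem sum_cosetRep_add (hB : B.IsSymm) (hb : ∀ i j, i ≠ j → B (b i) (b j) = 0)
    (hm : ∀ i, 1 ≤ m i) (hu : ∀ i, B (b i) (b i) = 2 ^ m i * u i) (hu' : ∀ i, u i ∈ Z2)
    {l : V} (hl : ∀ i, 2 ^ m i * b.repr l i ∈ Z2) :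
    ∑ j, twoAdicChar (B (cosetRep b m j + l) (cosetRep b m j + l) / 2) = gaussSum B b m := by
  choose a ha using fun i => exists_int_sub_div_mem_Z2 (hl i) (m i)
  rw [gaussSum]
  refine Fintype.sum_equiv (Equiv.addRight fun i => (a i : ZMod (2 ^ m i))) _ _ fun j => ?_
  set x := cosetRep b m (Equiv.addRight (fun i => (a i : ZMod (2 ^ m i))) j) with hx
  have hxi : ∀ i, b.repr x i = ((j i + a i : ZMod (2 ^ m i)).val : ℚ) / 2 ^ m i :=
    fun i => repr_cosetRep b m _ i
  set z := cosetRep b m j + l - x with hz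
  -- the two representatives differ by a vector `z` of `⨁ ℤ_(2) b i`
  have hzi : ∀ i, b.repr z i ∈ Z2 := by
    intro i
    have hd : (2 : ℤ) ^ m i ∣ (j i).val + a i - (j i + a i : ZMod (2 ^ m i)).val := by
      have := (ZMod.intCast_zmod_eq_zero_iff_dvd
        ((j i).val + a i - (j i + a i : ZMod (2 ^ m i)).val) (2 ^ m i)).1 (by
          push_cast
          rw [ZMod.natCast_zmod_val, ZMod.natCast_zmod_val, sub_self])
      exact_mod_cast this
    rw [hz, map_sub, map_add, Finsupp.sub_apply, Finsupp.add_apply, repr_cosetRep, hxi]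
    convert add_mem (ha i) (intCast_div_mem_Z2_iff.2 hd) using 1
    push_cast
    field_simp
    ring
  suffices hxz : B x z + B z z / 2 ∈ Z2 by
    rw [show cosetRep b m j + l = x + z by rw [hz]; abel, twoAdicChar_half_add hB,
      twoAdicChar_eq_one hxz, mul_one]
  refine add_mem ?_ ?_
  · rw [bilin_eq_sum_of_orthogonal B b hb]
    refine sum_mem fun i _ => ?_
    rw [hu, hxi]
    convert mul_mem (mul_mem (nat_mem_Z2 (j i + a i : ZMod (2 ^ m i)).val) (hzi i)) (hu' i) using 1
    field_simp
  · rw [bilin_eq_sum_of_orthogonal B b hb, Finset.sum_div]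
    refine sum_mem fun i _ => ?_
    obtain ⟨r, hr⟩ := Nat.exists_eq_add_of_le' (hm i)
    rw [hu, hr]
    convert mul_mem (mul_mem (mul_mem (hzi i) (hzi i)) (nat_mem_Z2 (2 ^ r))) (hu' i) using 1
    push_cast
    ring

/-- If `L` is unimodular at `2` and `2 v` is a characteristic vector of `L`, then averaging the
Gauss sum over translations by `L` kills all terms but those from cosets meeting `-v + L`, each of
which contributes the same value `e (v · v / 2)`. -/
theorem gaussSum_eq_of_characteristic (hB : B.IsSymm) (hb : ∀ i j, i ≠ j → B (b i) (b j) = 0)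
    (hm : ∀ i, 1 ≤ m i) (hu : ∀ i, B (b i) (b i) = 2 ^ m i * u i) (hu' : ∀ i, u i ∈ Z2)
    {L : Submodule ℤ V} {ι : Type*} [Fintype ι] {l : ι → V} (hlL : ∀ a, l a ∈ L)
    (hl : ∀ a i, 2 ^ m i * b.repr (l a) i ∈ Z2) {v : V}
    (hv : ∀ y ∈ L, (B y y - 2 * B v y) / 2 ∈ Z2)
    (hdual : ∀ x, (∀ a, B x (l a) ∈ Z2) → (B x x - 2 * B v x) / 2 ∈ Z2) :
    ∃ c : ℝ, 0 ≤ c ∧ gaussSum B b m = c * twoAdicChar (B v v / 2) := by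
  classical
  let s := cosetRep b m
  obtain ⟨N, hN⟩ := exists_pow_two_mul_mem_Z2_of_finite
    fun p : (∀ i, ZMod (2 ^ m i)) × ι => B (s p.1 + v) (l p.2)
  replace hN := hN N le_rfl
  let K : ℝ := (2 ^ N) ^ Fintype.card ι
  have hK : 0 < K := by positivity
  have hshift : ∀ c : ι → ℕ, gaussSum B b m = ∑ j, twoAdicChar (B (s j) (s j) / 2) *
      ∏ a, twoAdicChar (c a * B (s j + v) (l a)) := by
    intro c
    let y := ∑ a, (c a : ℤ) • l a
    have hyL : y ∈ L := sum_mem fun a _ => L.smul_mem _ (hlL a)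
    have hyi : ∀ i, 2 ^ m i * b.repr y i ∈ Z2 := by
      intro i
      have : 2 ^ m i * b.repr y i = ∑ a, (c a : ℤ) * (2 ^ m i * b.repr (l a) i) := by
        simp only [y, map_sum, map_zsmul, Finsupp.finsetSum_apply, Finsupp.smul_apply,
          zsmul_eq_mul, Finset.mul_sum]
        exact Finset.sum_congr rfl fun a _ => by ring
      rw [this]
      exact sum_mem fun a _ => mul_mem (int_mem_Z2 _) (hl a i)
    rw [← sum_cosetRep_add hB hb hm hu hu' hyi]
    refine Finset.sum_congr rfl fun j _ => ?_
    rw [twoAdicChar_half_add hB, ← addChar_map_sum]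
    congr 1
    apply twoAdicChar_congr
    have hsum : ∑ a, c a * B (s j + v) (l a) = B (s j) y + B v y := by
      simp only [y, map_sum, map_zsmul, zsmul_eq_mul, map_add, LinearMap.add_apply,
        ← Finset.sum_add_distrib]
      exact Finset.sum_congr rfl fun a _ => by push_cast; ring
    rw [hsum]
    convert hv y hyL using 1
    ring
  have hterm : ∀ j, twoAdicChar (B (s j) (s j) / 2) *
      ∏ a, ∑ k ∈ Finset.range (2 ^ N), twoAdicChar (k * B (s j + v) (l a)) =
      ((if ∀ a, B (s j + v) (l a) ∈ Z2 then K else 0 : ℝ) : ℂ) * twoAdicChar (B v v / 2) := by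
    intro j
    simp_rw [sum_range_pow_two_twoAdicChar (hN (j, _))]
    split_ifs with h
    · rw [Finset.prod_congr rfl fun a _ => if_pos (h a)]
      rw [Finset.prod_const, Finset.card_univ, mul_comm]
      congr 1
      · simp [K]
      · apply twoAdicChar_congr
        convert hdual _ h using 1
        have : B v (s j) = B (s j) v := hB.eq v (s j)
        simp only [map_add, LinearMap.add_apply, this]
        ring
    · push Not at h
      obtain ⟨a, ha⟩ := h
      rw [Finset.prod_eq_zero (Finset.mem_univ a) (if_neg ha)]
      simp
  have htot : K * gaussSum B b m =
      ((∑ j, if ∀ a, B (s j + v) (l a) ∈ Z2 then K else 0 : ℝ) : ℂ) *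
        twoAdicChar (B v v / 2) := by
    calc (K : ℂ) * gaussSum B b m
        = ∑ c ∈ Fintype.piFinset fun _ : ι => Finset.range (2 ^ N), gaussSum B b m := by
          simp [K, Fintype.card_piFinset]
      _ = ∑ c ∈ Fintype.piFinset fun _ : ι => Finset.range (2 ^ N),
          ∑ j, twoAdicChar (B (s j) (s j) / 2) *
            ∏ a, twoAdicChar (c a * B (s j + v) (l a)) :=
          Finset.sum_congr rfl fun c _ => hshift c
      _ = ∑ j, twoAdicChar (B (s j) (s j) / 2) *
          ∏ a, ∑ k ∈ Finset.range (2 ^ N), twoAdicChar (k * B (s j + v) (l a)) := by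
          rw [Finset.sum_comm]
          refine Finset.sum_congr rfl fun j _ => ?_
          rw [Finset.prod_univ_sum, Finset.mul_sum]
      _ = _ := by
          rw [Finset.sum_congr rfl fun j _ => hterm j, ← Finset.sum_mul, Complex.ofReal_sum]
  refine ⟨(∑ j, if ∀ a, B (s j + v) (l a) ∈ Z2 then K else 0) / K,
    div_nonneg (Finset.sum_nonneg fun j _ => by split_ifs <;> positivity) hK.le, ?_⟩
  have hK' : (K : ℂ) ≠ 0 := by exact_mod_cast hK.ne'
  rw [Complex.ofReal_div, div_mul_eq_mul_div, ← htot, mul_div_cancel_left₀ _ hK']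

theorem eq_of_pos_mul_eq {c d : ℝ} {x y : ℂ} (hc : 0 ≤ c) (hd : 0 < d) (hx : ‖x‖ = 1)
    (hy : ‖y‖ = 1) (h : c * x = d * y) : x = y := by
  have h1 : c = d := by
    have := congrArg norm h
    simpa [hx, hy, abs_of_nonneg hc, abs_of_pos hd] using this
  rw [h1] at h
  exact mul_left_cancel₀ (by exact_mod_cast hd.ne') h

/-- If `L` is unimodular at `2` and `2 v` is a characteristic vector of `L`, then `v · v` is a
quarter of the oddity. -/
theorem norm_half_characteristic (hB : B.IsSymm) {o : ℤ} (ho : IsOddity B (o : ZMod 8))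
    (hnd : ∀ x, (∀ y, B x y = 0) → x = 0)
    {L : Submodule ℤ V} {ι : Type*} [Finite ι] {l : ι → V} (hlL : ∀ a, l a ∈ L) {v : V}
    (hv : ∀ y ∈ L, (B y y - 2 * B v y) / 2 ∈ Z2)
    (hdual : ∀ x, (∀ a, B x (l a) ∈ Z2) → (B x x - 2 * B v x) / 2 ∈ Z2) :
    (B v v - o / 4) / 2 ∈ Z2 := by
  have := Fintype.ofFinite ι
  obtain ⟨n, b, hb, ho⟩ := ho
  set d : Fin n → ℚ := fun i => B (b i) (b i) with hd
  have hd0 : ∀ i, d i ≠ 0 := fun i h => b.ne_zero i <| hnd _ fun y => by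
    rw [bilin_eq_sum_of_orthogonal B b hb]
    refine Finset.sum_eq_zero fun j _ => ?_
    rw [b.repr_self]
    by_cases hij : i = j
    · subst hij
      rw [show B (b i) (b i) = 0 from h, mul_zero]
    · rw [Finsupp.single_eq_of_ne (Ne.symm hij), zero_mul, zero_mul]
  -- rescale the orthogonal basis by a large power of two
  obtain ⟨N₁, hN₁⟩ := exists_pow_two_mul_mem_Z2_of_finite
    fun p : ι × Fin n => 2 ^ padicValRat 2 (d p.2) * b.repr (l p.1) p.2
  obtain ⟨N₂, hN₂⟩ := (Set.finite_range fun i => (1 - padicValRat 2 (d i)).toNat).bddAbove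
  set k := max N₁ N₂ with hk
  have hmk' : ∀ i, 1 - padicValRat 2 (d i) ≤ k := fun i => by
    have h1 : (1 - padicValRat 2 (d i)).toNat ≤ N₂ := hN₂ ⟨i, rfl⟩
    have := le_max_right N₁ N₂
    omega
  let m : Fin n → ℕ := fun i => (padicValRat 2 (d i) + 2 * k).toNat
  have hm' : ∀ i, (m i : ℤ) = padicValRat 2 (d i) + 2 * k := fun i => by
    have := hmk' i
    simp only [m]
    omega
  have hm : ∀ i, 1 ≤ m i := fun i => by
    have := hmk' i
    have := hm' i
    omega
  have hm2 : ∀ i, (2 : ℚ) ^ m i = 2 ^ padicValRat 2 (d i) * 2 ^ k * 2 ^ k := fun i => by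
    rw [← zpow_natCast, hm', two_mul, zpow_add₀ (by norm_num), zpow_add₀ (by norm_num),
      zpow_natCast, mul_assoc]
  let w : Fin n → ℚˣ := fun _ => Units.mk0 (2 ^ k) (by positivity)
  let b' := b.unitsSMul w
  have hb' : ∀ i, b' i = (2 ^ k : ℚ) • b i := fun i => by
    simp [b', w, Module.Basis.unitsSMul_apply, Units.smul_def]
  have hrepr : ∀ x i, b'.repr x i = (2 ^ k)⁻¹ * b.repr x i := fun x i => by
    simp [b', w, Module.Basis.repr_unitsSMul, Units.smul_def]
  have horth : ∀ i j, i ≠ j → B (b' i) (b' j) = 0 := fun i j hij => by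
    rw [hb', hb', map_smul, map_smul, LinearMap.smul_apply, hb i j hij]
    simp
  set u : Fin n → ℚ := fun i => d i / 2 ^ padicValRat 2 (d i) with hu
  have hbu : ∀ i, B (b' i) (b' i) = 2 ^ m i * u i := fun i => by
    rw [hb', map_smul, map_smul, LinearMap.smul_apply, hm2, hu]
    simp only [smul_eq_mul]
    field_simp
    rfl
  have hu' : ∀ i, u i ∈ Z2 := fun i => (exists_odd_sub_oddPart_div (hd0 i)).1
  have hlb : ∀ a i, 2 ^ m i * b'.repr (l a) i ∈ Z2 := fun a i => by
    rw [hrepr, hm2]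
    convert hN₁ k (le_max_left _ _) (a, i) using 1
    field_simp
  obtain ⟨c₁, hc₁, h₁⟩ := gaussSum_eq_of_characteristic hB horth hm hbu hu' hlL hlb hv hdual
  obtain ⟨c₂, hc₂, h₂⟩ := prod_gaussSum₁_eq hd0 hm hm'
  rw [gaussSum_eq_prod horth hbu, h₂, ← ho, ← twoAdicChar_int_div_eight] at h₁
  have h := eq_of_pos_mul_eq hc₁ hc₂ (norm_twoAdicChar _) (norm_twoAdicChar _) h₁.symm
  have h3 : twoAdicChar (B v v / 2 - o / 8) = 1 := by
    rw [AddChar.map_sub_eq_div, h, div_self]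
    intro h0
    have := norm_twoAdicChar (o / 8)
    rw [h0] at this
    simp at this
  convert twoAdicChar_eq_one_iff.1 h3 using 1
  ring

end

/-! ### Duals and shadows at the prime two -/

section

variable {V : Type*} [AddCommGroup V] [Module ℚ V]

theorem exists_odd_smul_sum_mem {L : Submodule ℤ V} {ι : Type*} [Fintype ι] {l : ι → V}
    (hlL : ∀ a, l a ∈ L) (c : ι → ℚ) (hc : ∀ a, c a ∈ Z2) :
    ∃ k : ℤ, Odd k ∧ k • ∑ a, c a • l a ∈ L := by
  obtain ⟨k, hk, h⟩ := exists_odd_mul_eq_int c hc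
  refine ⟨k, hk, ?_⟩
  rw [Finset.smul_sum]
  refine sum_mem fun a _ => ?_
  obtain ⟨z, hz⟩ := h a
  rw [← Int.cast_smul_eq_zsmul ℚ, smul_smul, hz, Int.cast_smul_eq_zsmul]
  exact L.smul_mem _ (hlL a)

theorem exists_eq_sum_basis (L : Submodule ℤ V) [Submodule.IsLattice ℚ L] (x : V) :
    ∃ c : Module.Free.ChooseBasisIndex ℤ L → ℚ,
      x = ∑ a, c a • (Module.Free.chooseBasis ℤ L a : V) := by
  let b := (Module.Free.chooseBasis ℤ L).extendOfIsLattice ℚ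
  refine ⟨b.repr x, ?_⟩
  conv_lhs => rw [← b.sum_repr x]
  simp [b]

variable (B : LinearMap.BilinForm ℚ V) (L : Submodule ℤ V) [Submodule.IsLattice ℚ L]

/-- Cramer's rule for the Gram matrix of a lattice basis. -/
theorem latticeDet_mul_coord (c : Module.Free.ChooseBasisIndex ℤ L → ℚ)
    (a : Module.Free.ChooseBasisIndex ℤ L) :
    latticeDet B L * c a = ∑ i, (Matrix.of fun i j : Module.Free.ChooseBasisIndex ℤ L =>
      B (Module.Free.chooseBasis ℤ L i : V) (Module.Free.chooseBasis ℤ L j : V)).adjugate i a *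
      B (∑ j, c j • (Module.Free.chooseBasis ℤ L j : V)) (Module.Free.chooseBasis ℤ L i) := by
  set G := (Matrix.of fun i j : Module.Free.ChooseBasisIndex ℤ L =>
      B (Module.Free.chooseBasis ℤ L i : V) (Module.Free.chooseBasis ℤ L j : V)) with hG
  have h1 : ∀ i, B (∑ j, c j • (Module.Free.chooseBasis ℤ L j : V))
      (Module.Free.chooseBasis ℤ L i) = Matrix.vecMul c G i := by
    intro i
    simp [Matrix.vecMul, dotProduct, hG]
  have h2 : Matrix.vecMul (Matrix.vecMul c G) G.adjugate = G.det • c := by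
    rw [Matrix.vecMul_vecMul, Matrix.mul_adjugate, Matrix.vecMul_smul, Matrix.vecMul_one]
  have h3 := congrFun h2 a
  rw [Pi.smul_apply, smul_eq_mul] at h3
  rw [show latticeDet B L = G.det from rfl, ← h3]
  simp only [Matrix.vecMul, dotProduct] at h1 ⊢
  refine Finset.sum_congr rfl fun i _ => ?_
  rw [h1, mul_comm]

variable {B L}

theorem adjugate_mem {ι : Type*} [Fintype ι] [DecidableEq ι] {S : Subring ℚ} {G : Matrix ι ι ℚ}
    (hG : ∀ i j, G i j ∈ S) (i j : ι) : G.adjugate i j ∈ S := by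
  rw [Matrix.adjugate_apply, Matrix.det_apply]
  refine sum_mem fun σ _ => ?_
  rw [Units.smul_def]
  refine zsmul_mem (prod_mem fun k _ => ?_) _
  rw [Matrix.updateRow_apply]
  split_ifs
  · rw [Pi.single_apply]
    split_ifs
    exacts [one_mem _, zero_mem _]
  · exact hG _ _

/-- A lattice of odd determinant which is integral at `2` is its own dual at `2`. -/
theorem exists_odd_smul_mem (hL : IsTwoIntegral B L)
    (hdet : Odd (latticeDet B L).num ∧ Odd (latticeDet B L).den) {x : V}
    (hx : ∀ a, B x (Module.Free.chooseBasis ℤ L a) ∈ Z2) : ∃ k : ℤ, Odd k ∧ k • x ∈ L := by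
  obtain ⟨c, rfl⟩ := exists_eq_sum_basis L x
  refine exists_odd_smul_sum_mem (fun a => (Module.Free.chooseBasis ℤ L a).2) c fun a => ?_
  have h1 : latticeDet B L * c a ∈ Z2 := by
    rw [latticeDet_mul_coord]
    exact sum_mem fun i _ => mul_mem (adjugate_mem (fun i j =>
      hL _ (Module.Free.chooseBasis ℤ L i).2 _ (Module.Free.chooseBasis ℤ L j).2) _ _) (hx i)
  refine mem_Z2_of_odd_mul hdet.1 ?_
  rw [← Rat.mul_den_eq_num]
  convert mul_mem (nat_mem_Z2 (latticeDet B L).den) h1 using 1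
  ring

theorem eq_zero_of_latticeDet_ne_zero (hdet : latticeDet B L ≠ 0) {x : V}
    (hx : ∀ y, B x y = 0) : x = 0 := by
  obtain ⟨c, rfl⟩ := exists_eq_sum_basis L x
  refine Finset.sum_eq_zero fun a _ => ?_
  have h1 := latticeDet_mul_coord B L c a
  simp_rw [hx, mul_zero, Finset.sum_const_zero] at h1
  rw [(mul_eq_zero.1 h1).resolve_left hdet, zero_smul]

theorem exists_odd_smul_mem_dual (hL : IsTwoIntegral B L) :
    ∃ k : ℤ, Odd k ∧ ∀ x ∈ L, k • x ∈ dual B L := by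
  let b := Module.Free.chooseBasis ℤ L
  obtain ⟨k, hk, h⟩ := exists_odd_mul_eq_int (fun p : Module.Free.ChooseBasisIndex ℤ L ×
    Module.Free.ChooseBasisIndex ℤ L => B (b p.1) (b p.2)) fun p => hL _ (b p.1).2 _ (b p.2).2
  refine ⟨k, hk, fun x hx y hy => ?_⟩
  have hexp : ∀ z : L, (z : V) = ∑ a, b.repr z a • (b a : V) := fun z =>
    (congrArg L.subtype (b.sum_repr z).symm).trans (by rw [map_sum]; rfl)
  rw [show x = ((⟨x, hx⟩ : L) : V) from rfl, show y = ((⟨y, hy⟩ : L) : V) from rfl, hexp, hexp,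
    Submodule.mem_one]
  choose z hz using h
  refine ⟨∑ i, ∑ j, b.repr ⟨x, hx⟩ i * b.repr ⟨y, hy⟩ j * z (i, j), ?_⟩
  simp only [map_zsmul, map_sum, LinearMap.smul_apply, LinearMap.sum_apply, zsmul_eq_mul,
    Finset.mul_sum, eq_intCast, Int.cast_mul, ← hz]
  rw [Finset.sum_comm]
  refine Finset.sum_congr rfl fun i _ => Finset.sum_congr rfl fun j _ => ?_
  ring

theorem exists_int_of_mem_dual {M : Submodule ℤ V} {x y : V} (hx : x ∈ dual B M) (hy : y ∈ M) :
    ∃ z : ℤ, B x y = z := by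
  obtain ⟨z, hz⟩ := Submodule.mem_one.1 (hx y hy)
  exact ⟨z, by simpa using hz.symm⟩

theorem mem_Z2_of_forall_dual (hL : IsTwoIntegral B L) {x : V}
    (hx : ∀ y ∈ dual B L, B x y ∈ Z2) : ∀ y ∈ L, B x y ∈ Z2 := by
  obtain ⟨k, hk, h⟩ := exists_odd_smul_mem_dual hL
  intro y hy
  have := hx _ (h y hy)
  rw [map_zsmul, zsmul_eq_mul] at this
  exact mem_Z2_of_odd_mul hk this

/-- At the prime `2`, every `P`-dual of `L` coincides with `L`. -/
theorem exists_odd_smul_mem_of_mem_piDual (hL : IsTwoIntegral B L)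
    (hdet : Odd (latticeDet B L).num ∧ Odd (latticeDet B L).den) {P : Set Nat.Primes} {x : V}
    (hx : x ∈ piDual B L P) : ∃ k : ℤ, Odd k ∧ k • x ∈ L := by
  have h : ∀ y ∈ L, B x y ∈ Z2 := by
    by_cases hP : two ∈ P
    · exact fun y hy => hx.1 two hP y hy
    · exact mem_Z2_of_forall_dual hL fun y hy => hx.2 two hP y hy
  exact exists_odd_smul_mem hL hdet fun a => h _ (Module.Free.chooseBasis ℤ L a).2

theorem isTwoIntegral_piDual (hL : IsTwoIntegral B L)
    (hdet : Odd (latticeDet B L).num ∧ Odd (latticeDet B L).den) (P : Set Nat.Primes) :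
    IsTwoIntegral B (piDual B L P) := by
  intro x hx y hy
  obtain ⟨k, hk, hkx⟩ := exists_odd_smul_mem_of_mem_piDual hL hdet hx
  obtain ⟨j, hj, hjy⟩ := exists_odd_smul_mem_of_mem_piDual hL hdet hy
  have h : B (k • x) (j • y) ∈ Z2 := hL _ hkx _ hjy
  rw [map_zsmul, map_zsmul, LinearMap.smul_apply, zsmul_eq_mul, zsmul_eq_mul] at h
  exact mem_Z2_of_odd_mul hk (mem_Z2_of_odd_mul hj h)

/-- The converse inclusion at `2`, with a multiplier that serves for all vectors and all `P`. -/
theorem exists_odd_smul_mem_piDual (hB : B.IsSymm) (hL : IsTwoIntegral B L) :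
    ∃ k : ℤ, Odd k ∧ ∀ P : Set Nat.Primes, ∀ x ∈ L, k • x ∈ piDual B L P := by
  obtain ⟨k, hk, h⟩ := exists_odd_smul_mem_dual hL
  refine ⟨k, hk, fun P x hx => ⟨fun p _ y hy => ?_, fun p _ y hy => ?_⟩⟩
  · have := Fact.mk p.2
    obtain ⟨z, hz⟩ := exists_int_of_mem_dual (h x hx) hy
    rw [hz]
    exact int_inZp p z
  · have := Fact.mk p.2
    obtain ⟨z, hz⟩ := exists_int_of_mem_dual hy (L.smul_mem k hx)
    rw [← hB.eq, hz]
    exact int_inZp p z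

/-- The form is `2`-integral on the `2`-dual, so its denominators there are odd; they are bounded
because an odd multiple of the `2`-dual lies in `L^*`. -/
theorem odd_piLevel_two (hB : B.IsSymm) (hL : IsTwoIntegral B L)
    (hdet : Odd (latticeDet B L).num ∧ Odd (latticeDet B L).den) : Odd (piLevel B L {two}) := by
  set N := piDual B L {two} with hN
  have hN2 : IsTwoIntegral B N := isTwoIntegral_piDual hL hdet _
  -- vectors of the `2`-dual pair integrally with `L^*`, at `2` because they lie in `L` there
  have hint : ∀ x ∈ N, ∀ y ∈ dual B L, ∃ z : ℤ, B x y = z := by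
    refine fun x hx y hy => exists_int_of_forall_inZp fun p => ?_
    by_cases hp : p = two
    · subst hp
      obtain ⟨k, hk, hkx⟩ := exists_odd_smul_mem_of_mem_piDual hL hdet hx
      obtain ⟨z, hz⟩ := exists_int_of_mem_dual hy hkx
      rw [← hB.eq, map_zsmul, LinearMap.smul_apply, zsmul_eq_mul] at hz
      exact mem_Z2_of_odd_mul hk (hz ▸ int_mem_Z2 z)
    · exact hx.2 p hp y hy
  obtain ⟨k, hk, hkd⟩ := exists_odd_smul_mem_dual hL
  have hmul : ∀ x ∈ N, ∀ y ∈ N, ∃ z : ℤ, k * B x y = z := by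
    intro x hx y hy
    have hd : k • x ∈ dual B L := by
      intro w hw
      obtain ⟨z, hz⟩ := hint x hx _ (hkd w hw)
      rw [Submodule.mem_one]
      refine ⟨z, ?_⟩
      rw [map_zsmul, LinearMap.smul_apply, ← map_zsmul, hz]
      simp
    obtain ⟨z, hz⟩ := hint y hy _ hd
    refine ⟨z, ?_⟩
    rw [← hz, ← hB.eq, map_zsmul, zsmul_eq_mul]
  have hk0 : k ≠ 0 := by
    rintro rfl
    simp at hk
  have hmem : piLevel B L {two} ∈ {l : ℕ | 0 < l ∧ IsIntegral ((l : ℚ) • B) N} := by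
    refine Nat.sInf_mem ⟨k.natAbs, Int.natAbs_pos.2 hk0, fun x hx y hy => ?_⟩
    obtain ⟨z, hz⟩ := hmul x hx y hy
    rw [LinearMap.smul_apply, LinearMap.smul_apply, smul_eq_mul]
    obtain h | h := Int.natAbs_eq k
    · have h' : (k : ℚ) = (k.natAbs : ℚ) := by
        conv_lhs => rw [h]
        rfl
      exact ⟨z, by rw [← h', hz]⟩
    · have h' : (k : ℚ) = -(k.natAbs : ℚ) := by
        conv_lhs => rw [h]
        rw [Int.cast_neg]
        rfl
      exact ⟨-z, by rw [Int.cast_neg, ← hz, h', neg_mul, neg_neg]⟩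
  obtain ⟨hpos, hl⟩ := hmem
  rw [← Nat.not_even_iff_odd]
  rintro ⟨r, hr⟩
  -- an even level could be halved
  have hle : piLevel B L {two} ≤ r := by
    refine Nat.sInf_le ⟨by omega, fun x hx y hy => ?_⟩
    obtain ⟨z, hz⟩ := hl x hx y hy
    rw [LinearMap.smul_apply, LinearMap.smul_apply, smul_eq_mul, hr] at hz
    push_cast at hz
    have h2 : (z : ℚ) / 2 ^ 1 ∈ Z2 := by
      convert mul_mem (nat_mem_Z2 r) (hN2 x hx y hy) using 1
      rw [← hz]
      ring
    obtain ⟨w, hw⟩ := intCast_div_mem_Z2_iff.1 h2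
    refine ⟨w, ?_⟩
    rw [hw] at hz
    push_cast at hz
    rw [LinearMap.smul_apply, LinearMap.smul_apply, smul_eq_mul]
    linear_combination hz / 2
  omega

/-- Twice a shadow vector is a characteristic vector. -/
theorem characteristic_of_mem_shadow {C : LinearMap.BilinForm ℚ V} (hC : C.IsSymm)
    {M : Submodule ℤ V} (hM : IsTwoIntegral C M) {x : V} (hx : x ∈ shadow C M) :
    ∀ y ∈ M, (C y y - 2 * C x y) / 2 ∈ Z2 := by
  rw [shadow] at hx
  split_ifs at hx with h
  · intro y hy
    obtain ⟨z, hz⟩ := exists_int_of_mem_dual hx hy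
    convert sub_mem (inTwoZ2_iff.1 (h y hy)) (int_mem_Z2 z) using 1
    rw [hz]
    ring
  · obtain ⟨hx0, hx1⟩ := hx
    have hmem : ∀ y, y ∈ evenSublattice C M ↔ y ∈ M ∧ C y y / 2 ∈ Z2 := fun y => by
      rw [mem_evenSublattice hC hM, inTwoZ2_iff]
    have hint : ∀ y ∈ M, C y y / 2 ∈ Z2 → ∃ z : ℤ, C x y = z := fun y hy hy2 =>
      exists_int_of_mem_dual hx0 ((hmem y).2 ⟨hy, hy2⟩)
    have hpar : ∀ y ∈ M, C y y / 2 ∉ Z2 → (C y y - 1) / 2 ∈ Z2 := by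
      intro y hy hy2
      obtain ⟨a, ha⟩ := exists_int_sub_div_mem_Z2 (hM y hy y hy) 1
      obtain ⟨b, rfl | rfl⟩ := a.even_or_odd'
      · refine absurd ?_ hy2
        convert add_mem ha (int_mem_Z2 b) using 1
        push_cast
        ring
      · convert add_mem ha (int_mem_Z2 b) using 1
        push_cast
        ring
    -- a vector `w` outside the dual detects the odd vectors: `2 C x w` is odd, and the odd vectors of
    -- `M` are those congruent to `w` modulo the even sublattice
    obtain ⟨w, hw, hxw⟩ : ∃ w ∈ M, ¬ ∃ z : ℤ, C x w = z := by
      by_contra! hcon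
      refine hx1 fun w hw => ?_
      obtain ⟨z, hz⟩ := hcon w hw
      exact Submodule.mem_one.2 ⟨z, by simp [hz]⟩
    have hw2 : C w w / 2 ∉ Z2 := fun h2 => hxw (hint w hw h2)
    have hdbl : ∃ z : ℤ, 2 * C x w = z := by
      have := hint (w + w) (add_mem hw hw) (by
        convert mul_mem (int_mem_Z2 2) (hM w hw w hw) using 1
        simp only [map_add, LinearMap.add_apply]
        push_cast
        ring)
      rw [map_add, ← two_mul] at this
      exact this
    obtain ⟨t, ht⟩ := hdbl
    have htodd : Odd t := by
      rw [← Int.not_even_iff_odd]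
      rintro ⟨s, rfl⟩
      refine hxw ⟨s, ?_⟩
      push_cast at ht
      linear_combination ht / 2
    obtain ⟨s, rfl⟩ := htodd
    intro y hy
    by_cases hy2 : C y y / 2 ∈ Z2
    · obtain ⟨z, hz⟩ := hint y hy hy2
      convert sub_mem hy2 (int_mem_Z2 z) using 1
      rw [hz]
      ring
    · have hsym : C w y = C y w := hC.eq w y
      obtain ⟨z, hz⟩ := hint (y - w) (sub_mem hy hw) (by
        convert sub_mem (add_mem (add_mem (hpar y hy hy2) (hpar w hw hw2)) (one_mem _))
          (hM y hy w hw) using 1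
        simp only [map_sub, LinearMap.sub_apply, hsym]
        ring)
      rw [map_sub] at hz
      push_cast at ht
      convert sub_mem (hpar y hy hy2) (int_mem_Z2 (z + s)) using 1
      push_cast
      linear_combination -hz - ht / 2

/-- For `2 ∉ P`, write `v = l x` with `x` in the shadow for the form `l B`: then `2 x` is
characteristic for `l B`, and as `l` is odd, `2 v` is characteristic for `B`. -/
theorem characteristic_of_mem_piShadow (hB : B.IsSymm) (hL : IsTwoIntegral B L)
    (hdet : Odd (latticeDet B L).num ∧ Odd (latticeDet B L).den) {P : Set Nat.Primes} {v : V}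
    (hv : v ∈ piShadow B L P) : ∀ y ∈ piDual B L Pᶜ, (B y y - 2 * B v y) / 2 ∈ Z2 := by
  have hM := isTwoIntegral_piDual hL hdet Pᶜ
  rw [piShadow] at hv
  split_ifs at hv with h2
  · exact characteristic_of_mem_shadow hB hM hv
  · obtain ⟨x, hx, rfl⟩ := hv
    obtain ⟨r, hr⟩ := odd_piLevel_two hB hL hdet
    set c := piLevel B L {two}
    have hC : ((c : ℚ) • B).IsSymm := ⟨fun y z => by simp [hB.eq y z]⟩
    have hMC : IsTwoIntegral ((c : ℚ) • B) (piDual B L Pᶜ) := fun y hy z hz =>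
      mul_mem (nat_mem_Z2 c) (hM y hy z hz)
    intro y hy
    have h := characteristic_of_mem_shadow hC hMC hx y hy
    have h' := mul_mem (nat_mem_Z2 r) (hM y hy y hy)
    convert sub_mem h h' using 1
    simp only [map_smul, LinearMap.smul_apply, smul_eq_mul, hr]
    push_cast
    ring

end

end Shadow

open Shadow in
theorem theorem4 {V : Type*} [AddCommGroup V] [Module ℚ V]
    (B : LinearMap.BilinForm ℚ V) (hB : B.IsSymm)
    (L : Submodule ℤ V) [Submodule.IsLattice ℚ L]
    (hL : Shadow.IsTwoIntegral B L)
    (hdet : Odd (Shadow.latticeDet B L).num ∧ Odd (Shadow.latticeDet B L).den)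
    (P : Set Nat.Primes)
    (o : ℤ) (ho : Shadow.IsOddity B (o : ZMod 8))
    (v : V) (hv : v ∈ Shadow.piShadow B L P) :
    Shadow.InTwoZ2 (B v v - (o : ℚ) / 4) := by
  have hdet0 : latticeDet B L ≠ 0 := fun h => by simp [h] at hdet
  -- odd multiples do not affect the characteristic property
  have hchar : ∀ k : ℤ, Odd k → ∀ y, (B (k • y) (k • y) - 2 * B v (k • y)) / 2 ∈ Z2 →
      B y y ∈ Z2 → (B y y - 2 * B v y) / 2 ∈ Z2 := by
    intro k hk y h hy
    obtain ⟨r, hr⟩ := id hk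
    refine mem_Z2_of_odd_mul hk ?_
    convert sub_mem h (mul_mem (int_mem_Z2 (k * r)) hy) using 1
    simp only [map_zsmul, LinearMap.smul_apply, zsmul_eq_mul, hr]
    push_cast
    ring
  have hvL : ∀ y ∈ L, (B y y - 2 * B v y) / 2 ∈ Z2 := by
    intro y hy
    obtain ⟨k, hk, h⟩ := exists_odd_smul_mem_piDual hB hL
    exact hchar k hk y (characteristic_of_mem_piShadow hB hL hdet hv _ (h Pᶜ y hy)) (hL y hy y hy)
  refine inTwoZ2_iff.2 (norm_half_characteristic hB ho
    (fun x hx => eq_zero_of_latticeDet_ne_zero hdet0 hx)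
    (fun a => (Module.Free.chooseBasis ℤ L a).2) hvL fun x hx => ?_)
  obtain ⟨k, hk, hkx⟩ := exists_odd_smul_mem hL hdet hx
  refine hchar k hk x (hvL _ hkx) ?_
  have h : B (k • x) (k • x) ∈ Z2 := hL _ hkx _ hkx
  rw [map_zsmul, map_zsmul, LinearMap.smul_apply, zsmul_eq_mul, zsmul_eq_mul] at h
  exact mem_Z2_of_odd_mul hk (mem_Z2_of_odd_mul hk h)
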